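/- Let $d\ge 1$, let $X_1,X_2,\dots$ be i.i.d. $\mathbb{Z}^d$-valued random variables on a probability space $(\Omega,\mathcal F,\mathbb P)$, and for $x\in\mathbb{Z}^d$ let $\mathbb{P}_x$ denote the law under which $S_0=x$ and $S_n=x+X_1+\dots+X_n$, $n\ge 1$; on the space $\mathbb{Z}^d\times\Omega$ one takes $\mathbb P_x=\delta_x\times\mathbb P$. Put $p_n(x)=\mathbb{P}_0(S_n=x)$. Assume that the walk is symmetric, i.e. $p_1(x)=p_1(-x)$ for all $x\in\mathbb{Z}^d$, and strongly transient, i.e. $\sum_{n\ge 0}p_n(0)<\infty$ and $\sum_{n\ge 1}n\,p_n(0)<\infty$. For $A\subseteq\mathbb{Z}^d$ let $T_A^+=\inf\{n\ge 1: S_n\in A\}$ (with $\inf\emptyset=\infty$) and $$\mathrm{Cap}(A)=\sum_{x\in A}\mathbb{P}_x(T_A^+=\infty),$$ and let $\mathcal{C}_n=\mathrm{Cap}(\{S_0,\dots,S_n\})$. Then there is a (deterministic) real number $\mu_d$ such that $$\lim_{n\to\infty}\frac{\mathcal{C}_n}{n}=\mu_d\qquad \mathbb{P}_0\text{-almost surely},$$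 and $\mu_d>0$. -/

import Mathlib

open MeasureTheory ProbabilityTheory Filter Topology
open scoped ENNReal

namespace LatticeWalk

/-- The position `S_n(x, ω) = x + X_1(ω) + ⋯ + X_n(ω)` of the walk on the enlarged sample space
`ℤ^d × Ω`. The steps are indexed from zero, so the `n`-th step is `X (n - 1)`. -/
def walk {Ω : Type*} {d : ℕ} (X : ℕ → Ω → (Fin d → ℤ)) (n : ℕ) (w : (Fin d → ℤ) × Ω) :
    Fin d → ℤ :=
  w.1 + ∑ i ∈ Finset.range n, X i w.2

/-- The law `ℙ_x = δ_x × ℙ` on `ℤ^d × Ω`, under which the walk starts from `x`. -/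
noncomputable def startAt {Ω : Type*} [MeasurableSpace Ω] {d : ℕ} (P : Measure Ω)
    (x : Fin d → ℤ) : Measure ((Fin d → ℤ) × Ω) :=
  (Measure.dirac x).prod P

/-- The transition probability `p_n(x, y) = ℙ_x(S_n = y)`. -/
noncomputable def transProb {Ω : Type*} [MeasurableSpace Ω] {d : ℕ} (P : Measure Ω)
    (X : ℕ → Ω → (Fin d → ℤ)) (n : ℕ) (x y : Fin d → ℤ) : ℝ≥0∞ :=
  startAt P x {w | walk X n w = y}

/-- The Green function `G(x, y) = ∑_{n ≥ 0} p_n(x, y)`, with values in `[0, ∞]`. -/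
noncomputable def green {Ω : Type*} [MeasurableSpace Ω] {d : ℕ} (P : Measure Ω)
    (X : ℕ → Ω → (Fin d → ℤ)) (x y : Fin d → ℤ) : ℝ≥0∞ :=
  ∑' n : ℕ, transProb P X n x y

/-- The walk is transient if `G(0, 0) < ∞`. -/
def IsTransient {Ω : Type*} [MeasurableSpace Ω] {d : ℕ} (P : Measure Ω)
    (X : ℕ → Ω → (Fin d → ℤ)) : Prop :=
  green P X 0 0 < ∞

/-- The walk is strongly transient if it is transient and `∑_{n ≥ 1} n p_n(0) < ∞`. -/
def IsStronglyTransient {Ω : Type*} [MeasurableSpace Ω] {d : ℕ} (P : Measure Ω)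
    (X : ℕ → Ω → (Fin d → ℤ)) : Prop :=
  IsTransient P X ∧ ∑' n : ℕ, (n : ℝ≥0∞) * transProb P X n 0 0 < ∞

/-- The walk is symmetric if its one-step distribution is: `p_1(0, x) = p_1(0, -x)`. -/
def IsSymmetric {Ω : Type*} [MeasurableSpace Ω] {d : ℕ} (P : Measure Ω)
    (X : ℕ → Ω → (Fin d → ℤ)) : Prop :=
  ∀ x : Fin d → ℤ, transProb P X 1 0 x = transProb P X 1 0 (-x)

/-- The first return time `T_A^+ = inf {n ≥ 1 : S_n ∈ A}`, equal to `∞` if there is no return. -/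
noncomputable def returnTime {Ω : Type*} {d : ℕ} (X : ℕ → Ω → (Fin d → ℤ))
    (A : Set (Fin d → ℤ)) (w : (Fin d → ℤ) × Ω) : ℕ∞ :=
  ⨅ (n : ℕ) (_ : 1 ≤ n ∧ walk X n w ∈ A), (n : ℕ∞)

/-- The capacity `Cap(A) = ∑_{x ∈ A} ℙ_x(T_A^+ = ∞)`, with values in `[0, ∞]`. -/
noncomputable def capacity {Ω : Type*} [MeasurableSpace Ω] {d : ℕ} (P : Measure Ω)
    (X : ℕ → Ω → (Fin d → ℤ)) (A : Set (Fin d → ℤ)) : ℝ≥0∞ :=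
  ∑' x : A, startAt P (x : Fin d → ℤ) {w | returnTime X A w = ⊤}

/-- The range `R_n = {S_0, …, S_n}`. -/
def visited {Ω : Type*} {d : ℕ} (X : ℕ → Ω → (Fin d → ℤ)) (n : ℕ)
    (w : (Fin d → ℤ) × Ω) : Set (Fin d → ℤ) :=
  {y | ∃ k ≤ n, walk X k w = y}

/-- The capacity of the range is finite, so that reading it as a real number loses nothing. -/
theorem capacity_visited_ne_top {Ω : Type*} [MeasurableSpace Ω] {d : ℕ} (P : Measure Ω)
    [IsProbabilityMeasure P] (X : ℕ → Ω → (Fin d → ℤ)) (n : ℕ) (w : (Fin d → ℤ) × Ω) :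
    capacity P X (visited X n w) ≠ ∞ := by
  have hfin : (visited X n w).Finite :=
    (Set.finite_Iic n).image (fun k => walk X k w)
  have := hfin.fintype
  unfold capacity
  rw [tsum_fintype]
  refine ENNReal.sum_ne_top.2 fun x _ => ?_
  unfold startAt
  exact measure_ne_top _ _

/-- The process `C_n = Cap(R_n)`, as a real number. -/
noncomputable def capRange {Ω : Type*} [MeasurableSpace Ω] {d : ℕ} (P : Measure Ω)
    (X : ℕ → Ω → (Fin d → ℤ)) (n : ℕ) (w : (Fin d → ℤ) × Ω) : ℝ :=
  (capacity P X (visited X n w)).toReal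

end LatticeWalk

/-! The capacity `C_n` of the range is a functional of the first `n` steps and lies in `[0, n + 1]`.
Capacity is subadditive under unions and translation invariant, so `C_{m+n} ≤ C_m + C_n ∘ shift_m`.
For such functionals of an i.i.d. sequence, `exists_tendsto_of_subadditive` shows that `C_n / n`
converges almost surely to `γ = inf_n E[C_n] / n`. The upper bound is the law of large numbers for
blocks. For the lower bound, an unusually small liminf would occur almost surely by a zero-one law,
and a greedy cutting into cheap blocks (`le_greedy_blocks`) would then make the means too small.

Positivity of `γ` needs `E[C_n] ≥ δ n` (`exists_linear_lower_bound`). By the last exit decomposition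
and the symmetry of `G`, capacity is monotone (`finCap_mono`), so it suffices to keep the positions
at multiples of a fixed `L`. With `q` the probability of never returning to the origin, `k` points
have capacity at least `k q` minus the sum of `G` over ordered pairs (`card_mul_escape_le`).
Symmetry gives `E[G(S_m)] = ∑_k p_{m+k}(0)`, and summing over `m` gives `∑ (n+1) p_n(0)`, finite by
strong transience. For large `L` the pair sum therefore costs at most `q / 2` per point. -/

namespace LatticeWalk

/-! ### I.i.d. sequences: the shift, independence and zero-one laws. -/

section IIDSequence

variable {V : Type*}

/-- Drop the first `m` terms of a sequence. -/
def shift (m : ℕ) (s : ℕ → V) : ℕ → V := fun i => s (m + i)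

lemma shift_shift (m n : ℕ) (s : ℕ → V) : shift m (shift n s) = shift (n + m) s := by
  funext i
  simp [shift, add_assoc]

@[simp] lemma shift_zero (s : ℕ → V) : shift 0 s = s := by
  funext i
  simp [shift]

lemma dependsOn_comp_shift {β : Type*} {f : (ℕ → V) → β} {m : ℕ}
    (hf : DependsOn f (Set.Iio m)) (n : ℕ) :
    DependsOn (fun s => f (shift n s)) (Set.Iio (n + m)) := by
  intro x y h
  refine hf fun i hi => h (n + i) ?_
  simp only [Set.mem_Iio] at hi ⊢
  omega

variable [MeasurableSpace V]

@[fun_prop]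
lemma measurable_shift (m : ℕ) : Measurable (shift m : (ℕ → V) → ℕ → V) := by
  unfold shift
  fun_prop

/-- The law of an i.i.d. sequence with common law `ν`. -/
noncomputable def seqLaw (ν : Measure V) : Measure (ℕ → V) := Measure.infinitePi fun _ => ν

variable (ν : Measure V) [IsProbabilityMeasure ν]

instance : IsProbabilityMeasure (seqLaw ν) := by
  unfold seqLaw
  infer_instance

lemma measurePreserving_shift (m : ℕ) :
    MeasurePreserving (shift m) (seqLaw ν) (seqLaw ν) := by
  refine ⟨measurable_shift m, ?_⟩
  exact Measure.map_infinitePi_infinitePi_of_inj (P := fun _ : ℕ => ν) (f := fun i => m + i)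
    (add_right_injective m)

lemma iIndepFun_eval : iIndepFun (fun (i : ℕ) (s : ℕ → V) => s i) (seqLaw ν) :=
  iIndepFun_infinitePi (P := fun _ : ℕ => ν) (X := fun _ v => v) fun _ => measurable_id

/-- The first `m` terms are independent of the remaining ones. -/
lemma indepFun_prefix_shift (m : ℕ) :
    IndepFun (fun (s : ℕ → V) (i : Fin m) => s i) (shift m) (seqLaw ν) := by
  have hle : ∀ i, MeasurableSpace.comap (fun s : ℕ → V => s i) inferInstance
      ≤ (inferInstance : MeasurableSpace (ℕ → V)) := fun i =>
    (measurable_pi_apply i).comap_le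
  have h := indep_iSup_of_disjoint hle (iIndepFun_eval ν) (S := Set.Iio m) (T := Set.Ici m)
    (Set.disjoint_left.2 fun i hi hi' => by simp at hi hi'; omega)
  rw [IndepFun_iff_Indep]
  refine indep_of_indep_of_le_left (indep_of_indep_of_le_right h ?_) ?_
  · rw [← measurable_iff_comap_le]
    refine (@measurable_pi_iff _ _ _ (_) _ _).2 fun i => ?_
    rw [measurable_iff_comap_le]
    exact le_iSup₂_of_le (m + i) (by simp) le_rfl
  · rw [← measurable_iff_comap_le]
    refine (@measurable_pi_iff _ _ _ (_) _ _).2 fun i => ?_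
    rw [measurable_iff_comap_le]
    exact le_iSup₂_of_le (i : ℕ) (by simp) le_rfl

section Countable

variable [Countable V] [MeasurableSingletonClass V] [Nonempty V]

/-- Prefixes of length `m` form a countable discrete space, so measurability of `f` comes for free.
-/
lemma exists_measurable_prefix {β : Type*} [MeasurableSpace β] {f : (ℕ → V) → β} {m : ℕ}
    (hf : DependsOn f (Set.Iio m)) :
    ∃ g : (Fin m → V) → β, Measurable g ∧ ∀ s, f s = g fun i => s i := by
  classical
  obtain ⟨v⟩ := ‹Nonempty V›
  refine ⟨fun x => f fun i => if h : i < m then x ⟨i, h⟩ else v, Measurable.of_discrete,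
    fun s => hf fun i hi => ?_⟩
  simp only [Set.mem_Iio] at hi
  simp [hi]

lemma measurable_of_dependsOn_Iio {β : Type*} [MeasurableSpace β] {f : (ℕ → V) → β} {m : ℕ}
    (hf : DependsOn f (Set.Iio m)) : Measurable f := by
  obtain ⟨g, hg, h⟩ := exists_measurable_prefix hf
  rw [show f = fun s => g fun i => s i from funext h]
  fun_prop

lemma indepFun_of_dependsOn_shift {β γ : Type*} [MeasurableSpace β] [MeasurableSpace γ]
    {f : (ℕ → V) → β} {m : ℕ} (hf : DependsOn f (Set.Iio m)) {g : (ℕ → V) → γ}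
    (hg : Measurable g) : IndepFun f (fun s => g (shift m s)) (seqLaw ν) := by
  obtain ⟨f', hf', h⟩ := exists_measurable_prefix hf
  have := (indepFun_prefix_shift ν m).comp hf' hg
  rw [show f = f' ∘ (fun (s : ℕ → V) (i : Fin m) => s i) from funext h]
  exact this

end Countable

/-- A shift invariant event has probability zero or one. -/
lemma measure_zero_or_one_of_shift_invariant {t : Set (ℕ → V)} (ht : MeasurableSet t)
    (hinv : shift 1 ⁻¹' t = t) : seqLaw ν t = 0 ∨ seqLaw ν t = 1 := by
  have hn : ∀ n, shift n ⁻¹' t = t := by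
    intro n
    induction n with
    | zero => ext s; simp
    | succ n ih =>
      conv_rhs => rw [← ih, ← hinv]
      ext s
      simp only [Set.mem_preimage, shift_shift]
  refine measure_zero_or_one_of_measurableSet_limsup_atTop
    (s := fun i => MeasurableSpace.comap (fun s : ℕ → V => s i) inferInstance)
    (fun i => (measurable_pi_apply i).comap_le) (iIndepFun_eval ν) ?_
  rw [limsup_eq_iInf_iSup_of_nat, MeasurableSpace.measurableSet_iInf]
  intro n
  have hmeas : Measurable[⨆ i, ⨆ (_ : i ≥ n),
      MeasurableSpace.comap (fun s : ℕ → V => s i) inferInstance] (shift n : (ℕ → V) → ℕ → V) := by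
    refine (@measurable_pi_iff _ _ _ (_) _ _).2 fun i => ?_
    rw [measurable_iff_comap_le]
    exact le_iSup₂_of_le (n + i) (by simp) le_rfl
  -- Since `t` equals its preimage under `shift n`, it depends only on the terms from `n` on, for
  -- every `n`; Kolmogorov's law applies.
  have := hmeas ht
  rwa [hn n] at this

/-- An event that contains its preimage under the shift has probability zero or one. -/
lemma measure_zero_or_one_of_shift_subset {t : Set (ℕ → V)} (ht : MeasurableSet t)
    (hsub : shift 1 ⁻¹' t ⊆ t) : seqLaw ν t = 0 ∨ seqLaw ν t = 1 := by
  have hanti : Antitone fun n => shift n ⁻¹' t := by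
    refine antitone_nat_of_succ_le fun n s hs => ?_
    refine hsub ?_
    simpa only [Set.mem_preimage, shift_shift] using hs
  have hm : ∀ n, MeasurableSet (shift n ⁻¹' t) := fun n => measurable_shift n ht
  -- The preimages decrease and all have the measure of `t`, so their intersection, which is
  -- invariant, has it too.
  have hmeas : seqLaw ν (⋂ n, shift n ⁻¹' t) = seqLaw ν t := by
    have h1 := tendsto_measure_iInter_atTop (μ := seqLaw ν)
      (fun n => (hm n).nullMeasurableSet) hanti ⟨0, measure_ne_top _ _⟩
    have h2 : (seqLaw ν ∘ fun n => shift n ⁻¹' t) = fun _ => seqLaw ν t := by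
      funext n
      exact (measurePreserving_shift ν n).measure_preimage ht.nullMeasurableSet
    rw [h2] at h1
    exact tendsto_nhds_unique h1 tendsto_const_nhds
  rw [← hmeas]
  refine measure_zero_or_one_of_shift_invariant ν (MeasurableSet.iInter hm) ?_
  ext s
  simp only [Set.mem_preimage, Set.mem_iInter, shift_shift]
  refine ⟨fun h n => ?_, fun h n => h (1 + n)⟩
  exact hanti (Nat.le_add_left n 1) (h n)

end IIDSequence

/-! ### The subadditive ergodic theorem. -/

section Subadditive

variable {V : Type*} {c : ℕ → (ℕ → V) → ℝ}

lemma sub_block_le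
    (hsub : ∀ m n s, c (m + n) s ≤ c m s + c n (shift m s)) (m k r : ℕ) (s : ℕ → V) :
    c (m * k + r) s ≤ ∑ j ∈ Finset.range k, c m (shift (m * j) s) + c r (shift (m * k) s) := by
  induction k generalizing r with
  | zero => simp
  | succ k ih =>
    rw [Finset.sum_range_succ, show m * (k + 1) + r = m * k + (m + r) by ring]
    have h1 := ih (m + r)
    have h2 := hsub m r (shift (m * k) s)
    rw [shift_shift, show m * k + m = m * (k + 1) by ring] at h2
    linarith

/-- Cut `[0, n)` greedily into blocks on which `c` is at most `b` per step and single steps. -/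
lemma le_greedy_blocks (hle : ∀ n s, c n s ≤ n + 1)
    (hsub : ∀ m n s, c (m + n) s ≤ c m s + c n (shift m s)) {b : ℝ} (hb : 0 ≤ b) (N : ℕ) (n : ℕ)
    (s : ℕ → V) :
    c n s ≤ b * n + 2 * ∑ k ∈ Finset.range n,
      {s | ∀ l, 1 ≤ l → l ≤ N → b * l < c l s}.indicator 1 (shift k s) + (N + 2) := by
  set B : Set (ℕ → V) := {s | ∀ l, 1 ≤ l → l ≤ N → b * l < c l s} with hB
  have hind : ∀ s, (0 : ℝ) ≤ B.indicator 1 s := fun s =>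
    Set.indicator_nonneg (fun _ _ => zero_le_one) s
  induction n using Nat.strong_induction_on generalizing s with
  | _ n ih =>
  rcases le_or_gt n N with hn | hn
  · have h1 := hle n s
    have h2 : (n : ℝ) ≤ N := by exact_mod_cast hn
    have h3 : 0 ≤ ∑ k ∈ Finset.range n, B.indicator (1 : (ℕ → V) → ℝ) (shift k s) :=
      Finset.sum_nonneg fun k _ => hind _
    have h4 : 0 ≤ b * n := by positivity
    linarith
  · have split : ∀ l, 1 ≤ l → l ≤ n → c n s ≤ c l s + (b * (n - l : ℝ) +
        2 * ∑ k ∈ Finset.Ico l n, B.indicator (1 : (ℕ → V) → ℝ) (shift k s) + (N + 2)) := by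
      intro l hl hln
      obtain ⟨r, rfl⟩ := Nat.exists_eq_add_of_le hln
      have h1 := hsub l r s
      have h2 := ih r (by omega) (shift l s)
      simp only [shift_shift] at h2
      rw [Finset.sum_Ico_eq_sum_range, Nat.add_sub_cancel_left]
      push_cast
      rw [add_sub_cancel_left]
      linarith
    -- At a bad point advance one step, which costs at most `c 1 ≤ 2`; at a good point jump over a
    -- block of cost at most `b` per step.
    by_cases hs : s ∈ B
    · have h1 := split 1 le_rfl (by omega)
      have h2 := hle 1 s
      have h3 : ∑ k ∈ Finset.range n, B.indicator (1 : (ℕ → V) → ℝ) (shift k s) =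
          1 + ∑ k ∈ Finset.Ico 1 n, B.indicator (1 : (ℕ → V) → ℝ) (shift k s) := by
        rw [Finset.range_eq_Ico, Finset.sum_eq_sum_Ico_succ_bot (by omega)]
        simp [hs]
      push_cast at h1 h2
      rw [h3]
      linarith
    · rw [hB, Set.mem_ofPred_eq] at hs
      push Not at hs
      obtain ⟨l, hl, hlN, hcl⟩ := hs
      have h1 := split l hl (by omega)
      have h3 : ∑ k ∈ Finset.Ico l n, B.indicator (1 : (ℕ → V) → ℝ) (shift k s) ≤
          ∑ k ∈ Finset.range n, B.indicator (1 : (ℕ → V) → ℝ) (shift k s) := by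
        rw [Finset.range_eq_Ico]
        exact Finset.sum_le_sum_of_subset_of_nonneg
          (Finset.Ico_subset_Ico_left (Nat.zero_le _)) fun k _ _ => hind _
      linarith

variable [MeasurableSpace V] [Countable V] [MeasurableSingletonClass V] [Nonempty V]
  (ν : Measure V) [IsProbabilityMeasure ν]

lemma integrable_of_bounds (hdep : ∀ n, DependsOn (c n) (Set.Iio n)) (h0 : ∀ n s, 0 ≤ c n s)
    (hle : ∀ n s, c n s ≤ n + 1) (n : ℕ) : Integrable (c n) (seqLaw ν) :=
  Integrable.of_bound (measurable_of_dependsOn_Iio (hdep n)).aestronglyMeasurable (n + 1 : ℝ)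
    (ae_of_all _ fun s => by rw [Real.norm_eq_abs, abs_of_nonneg (h0 n s)]; exact hle n s)

/-- The upper bound: the law of large numbers for consecutive blocks of length `m`. -/
lemma ae_le_tendsto_of_blocks (hdep : ∀ n, DependsOn (c n) (Set.Iio n)) (h0 : ∀ n s, 0 ≤ c n s)
    (hle : ∀ n s, c n s ≤ n + 1) (hsub : ∀ m n s, c (m + n) s ≤ c m s + c n (shift m s))
    {m : ℕ} (hm : 0 < m) :
    ∀ᵐ s ∂(seqLaw ν), ∃ u : ℕ → ℝ, Tendsto u atTop (𝓝 ((∫ s, c m s ∂(seqLaw ν)) / m)) ∧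
      ∀ n, c n s / n ≤ u n := by
  have hmeas := fun n => measurable_of_dependsOn_Iio (hdep n)
  have hlaw := strong_law_ae_real (μ := seqLaw ν) (fun j s => c m (shift (m * j) s))
    (by simpa using integrable_of_bounds ν hdep h0 hle m) ?_ ?_
  · filter_upwards [hlaw] with s hs
    -- Average over the complete blocks, times their number per unit time, plus the cost of the
    -- incomplete last block.
    refine ⟨fun n => (∑ j ∈ Finset.range (n / m), c m (shift (m * j) s)) / ((n / m : ℕ) : ℝ) *
      (((n / m : ℕ) : ℝ) / n) + (m + 1) / n, ?_, fun n => ?_⟩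
    · have hmR : (0 : ℝ) ≤ 1 / (m : ℝ) := by positivity
      have h1 : Tendsto (fun n : ℕ => ((n / m : ℕ) : ℝ) / n) atTop (𝓝 (1 / (m : ℝ))) := by
        have := (tendsto_nat_floor_mul_div_atTop hmR).comp tendsto_natCast_atTop_atTop
        refine this.congr fun n => ?_
        simp only [Function.comp_apply]
        rw [one_div_mul_eq_div, Nat.floor_div_natCast, Nat.floor_natCast]
      have h2 := hs.comp (Nat.tendsto_div_const_atTop hm.ne')
      have h3 : Tendsto (fun n : ℕ => ((m : ℝ) + 1) / n) atTop (𝓝 0) :=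
        tendsto_const_div_atTop_nhds_zero_nat _
      have := (h2.mul h1).add h3
      simpa [div_eq_mul_inv] using this
    · have hb := sub_block_le hsub m (n / m) (n % m) s
      rw [Nat.div_add_mod] at hb
      have hr := hle (n % m) (shift (m * (n / m)) s)
      have hr' : ((n % m : ℕ) : ℝ) ≤ m := by exact_mod_cast (Nat.mod_lt n hm).le
      have hk : (∑ j ∈ Finset.range (n / m), c m (shift (m * j) s)) / ((n / m : ℕ) : ℝ) *
          (((n / m : ℕ) : ℝ) / n) = (∑ j ∈ Finset.range (n / m), c m (shift (m * j) s)) / n := by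
        rcases Nat.eq_zero_or_pos (n / m) with h | h
        · simp [h]
        · have : ((n / m : ℕ) : ℝ) ≠ 0 := by positivity
          rw [div_mul_div_cancel₀ this]
      beta_reduce
      rw [hk, ← add_div]
      gcongr
      linarith
  · have key : ∀ i j, i < j → IndepFun (fun s => c m (shift (m * i) s))
        (fun s => c m (shift (m * j) s)) (seqLaw ν) := by
      intro i j hij
      refine indepFun_of_dependsOn_shift ν (m := m * j) ?_ (hmeas m)
      have h := dependsOn_comp_shift (hdep m) (m * i)
      refine fun x y hxy => h fun k hk => hxy k ?_
      have : m * (i + 1) ≤ m * j := Nat.mul_le_mul_left m hij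
      simp only [Set.mem_Iio] at hk ⊢
      rw [mul_add] at this
      omega
    intro i j hij
    rcases lt_or_gt_of_ne hij with h | h
    · exact key i j h
    · exact (key j i h).symm
  · intro i
    have h := (measurePreserving_shift ν (m * i))
    simp only [mul_zero, shift_zero]
    refine ⟨((hmeas m).comp (measurable_shift _)).aemeasurable, (hmeas m).aemeasurable, ?_⟩
    rw [show (fun s => c m (shift (m * i) s)) = c m ∘ shift (m * i) from rfl,
      ← Measure.map_map (hmeas m) (measurable_shift _), h.map_eq]

/-- Integrating the greedy bound and letting `n` grow gives `γ ≤ b + 2 P(B N)`. The bad events `B N`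
decrease to a null set, because almost every sequence starts with some cheap block. -/
lemma le_of_ae_frequently (hdep : ∀ n, DependsOn (c n) (Set.Iio n)) (h0 : ∀ n s, 0 ≤ c n s)
    (hle : ∀ n s, c n s ≤ n + 1) (hsub : ∀ m n s, c (m + n) s ≤ c m s + c n (shift m s))
    {γ b : ℝ} (hγ : ∀ n : ℕ, γ * n ≤ ∫ s, c n s ∂(seqLaw ν)) (hb : 0 ≤ b)
    (hfreq : ∀ᵐ s ∂(seqLaw ν), ∃ n : ℕ, 1 ≤ n ∧ c n s ≤ b * n) : γ ≤ b := by
  have hmeas := fun n => measurable_of_dependsOn_Iio (hdep n)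
  let B : ℕ → Set (ℕ → V) := fun N => {s | ∀ l, 1 ≤ l → l ≤ N → b * l < c l s}
  have hBm : ∀ N, MeasurableSet (B N) := fun N => by
    simp only [B, Set.ofPred_forall]
    exact MeasurableSet.iInter fun l => MeasurableSet.iInter fun _ => MeasurableSet.iInter fun _ =>
      measurableSet_lt measurable_const (hmeas l)
  have hB0 : Tendsto (fun N => (seqLaw ν).real (B N)) atTop (𝓝 0) := by
    have h1 := tendsto_measure_iInter_atTop (μ := seqLaw ν)
      (fun n => (hBm n).nullMeasurableSet)
      (fun M N hMN s hs l hl hlM => hs l hl (hlM.trans hMN)) ⟨0, measure_ne_top _ _⟩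
    have h2 : seqLaw ν (⋂ N, B N) = 0 := by
      refine measure_mono_null (fun s hs => ?_) (ae_iff.1 hfreq)
      rw [Set.mem_iInter] at hs
      rintro ⟨n, hn, hcn⟩
      exact absurd (hs n n hn le_rfl) (not_lt.2 hcn)
    rw [h2] at h1
    exact (ENNReal.tendsto_toReal_zero_iff (fun _ => measure_ne_top _ _)).2 h1
  have hN : ∀ N, γ ≤ b + 2 * (seqLaw ν).real (B N) := by
    intro N
    have hI : ∀ k, ∫ s, (B N).indicator (1 : (ℕ → V) → ℝ) (shift k s) ∂(seqLaw ν) =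
        (seqLaw ν).real (B N) := by
      intro k
      rw [← integral_indicator_one (hBm N)]
      have hf : AEStronglyMeasurable ((B N).indicator (1 : (ℕ → V) → ℝ))
          ((seqLaw ν).map (shift k)) :=
        ((measurable_one.indicator (hBm N))).aestronglyMeasurable
      rw [← integral_map (measurable_shift k).aemeasurable hf,
        (measurePreserving_shift ν k).map_eq]
    have hint : ∀ k, Integrable (fun s => (B N).indicator (1 : (ℕ → V) → ℝ) (shift k s))
        (seqLaw ν) := fun k =>
      (measurePreserving_shift ν k).integrable_comp_of_integrable
        ((integrable_const (1 : ℝ)).indicator (hBm N))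
    have hn : ∀ n : ℕ, γ * n ≤ b * n + 2 * (n * (seqLaw ν).real (B N)) + (N + 2) := by
      intro n
      refine (hγ n).trans ?_
      have hs := integrable_finsetSum (Finset.range n) fun k _ => hint k
      have hs2 := hs.const_mul 2
      have hs3 : Integrable (fun s => b * n +
          2 * ∑ k ∈ Finset.range n, (B N).indicator (1 : (ℕ → V) → ℝ) (shift k s)) (seqLaw ν) :=
        (integrable_const (b * n)).add hs2
      refine (integral_mono (integrable_of_bounds ν hdep h0 hle n)
        (hs3.add (integrable_const (N + 2 : ℝ)))
        fun s => le_greedy_blocks hle hsub hb N n s).trans_eq ?_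
      refine (integral_add hs3 (integrable_const (N + 2 : ℝ))).trans ?_
      rw [integral_add (integrable_const _) hs2, integral_const_mul (2 : ℝ),
        integral_finsetSum _ fun k _ => hint k]
      simp [hI]
    by_contra! hlt
    obtain ⟨n, hn'⟩ := exists_nat_gt ((N + 2) / (γ - (b + 2 * (seqLaw ν).real (B N))))
    rw [div_lt_iff₀ (by linarith)] at hn'
    linarith [hn n]
  have := ge_of_tendsto' ((tendsto_const_nhds (x := b)).add (hB0.const_mul 2)) hN
  simpa using this

/-- The subadditive ergodic theorem for functionals of an i.i.d. sequence. -/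
theorem exists_tendsto_of_subadditive (hdep : ∀ n, DependsOn (c n) (Set.Iio n))
    (h0 : ∀ n s, 0 ≤ c n s) (hle : ∀ n s, c n s ≤ n + 1)
    (hsub : ∀ m n s, c (m + n) s ≤ c m s + c n (shift m s)) :
    ∃ γ : ℝ, (∀ᵐ s ∂(seqLaw ν), Tendsto (fun n : ℕ => c n s / n) atTop (𝓝 γ)) ∧
      ∀ δ : ℝ, (∀ n : ℕ, 1 ≤ n → δ * n ≤ ∫ s, c n s ∂(seqLaw ν)) → δ ≤ γ := by
  have hmeas := fun n => measurable_of_dependsOn_Iio (hdep n)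
  let e : ℕ → ℝ := fun n => (∫ s, c (n + 1) s ∂(seqLaw ν)) / ((n + 1 : ℕ) : ℝ)
  have he0 : ∀ n, 0 ≤ e n := fun n => div_nonneg (integral_nonneg (h0 _)) (by positivity)
  have hbdd : BddBelow (Set.range e) := ⟨0, by rintro _ ⟨n, rfl⟩; exact he0 n⟩
  have hγ : ∀ n : ℕ, (⨅ n, e n) * n ≤ ∫ s, c n s ∂(seqLaw ν) := by
    intro n
    rcases n with _ | n
    · simpa using integral_nonneg (h0 0)
    · have h := ciInf_le hbdd n
      rwa [le_div_iff₀ (by positivity)] at h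
  refine ⟨⨅ n, e n, ?_, fun δ hδ => le_ciInf fun n => ?_⟩
  swap
  · rw [le_div_iff₀ (by positivity)]
    exact hδ (n + 1) (by omega)
  have hup : ∀ᵐ s ∂(seqLaw ν), ∀ m : ℕ, ∃ u : ℕ → ℝ, Tendsto u atTop (𝓝 (e m)) ∧
      ∀ n, c n s / n ≤ u n :=
    ae_all_iff.2 fun m => ae_le_tendsto_of_blocks ν hdep h0 hle hsub (Nat.succ_pos m)
  -- Rational levels keep the exceptional null sets countable in number.
  have hlow : ∀ᵐ s ∂(seqLaw ν), ∀ a : ℚ, (0 : ℝ) ≤ a → (a : ℝ) < ⨅ n, e n →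
      ∀ᶠ n : ℕ in atTop, (a : ℝ) * n < c n s := by
    refine ae_all_iff.2 fun a => ?_
    by_cases ha : (0 : ℝ) ≤ a
    swap
    · exact ae_of_all _ fun s h => absurd h ha
    by_cases haγ : (a : ℝ) < ⨅ n, e n
    swap
    · exact ae_of_all _ fun s _ h => absurd h haγ
    -- The free constant `C` absorbs the cost of one extra step. Subadditivity yields only one
    -- inclusion between `D` and its preimage, which is all the zero-one law requires.
    let D : Set (ℕ → V) := {s | ∃ C : ℕ, ∃ᶠ n : ℕ in atTop, c n s ≤ a * n + C}
    have hD : MeasurableSet D := by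
      simp only [D, frequently_atTop, Set.ofPred_exists, Set.ofPred_forall]
      refine MeasurableSet.iUnion fun C => MeasurableSet.iInter fun n => MeasurableSet.iUnion
        fun k => ?_
      by_cases hk : n ≤ k
      · simpa [hk] using measurableSet_le (hmeas k) measurable_const
      · simp [hk]
    have hDsub : shift 1 ⁻¹' D ⊆ D := by
      rintro s ⟨C, hC⟩
      refine ⟨C + 2, ?_⟩
      rw [frequently_atTop] at hC ⊢
      intro n
      obtain ⟨k, hk, hck⟩ := hC n
      refine ⟨1 + k, by omega, ?_⟩
      have h1 := hsub 1 k s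
      have h2 := hle 1 s
      push_cast at h2 ⊢
      linarith
    have hD0 : seqLaw ν D = 0 := by
      refine (measure_zero_or_one_of_shift_subset ν hD hDsub).resolve_right fun h1 => ?_
      -- The gap `b - a` pays for `C` once `n` is large.
      obtain ⟨b, hab, hbγ⟩ := exists_between haγ
      refine absurd (le_of_ae_frequently ν hdep h0 hle hsub hγ (ha.trans hab.le) ?_)
        (not_le.2 hbγ)
      have hae : ∀ᵐ s ∂(seqLaw ν), s ∈ D := (prob_compl_eq_zero_iff hD).2 h1
      filter_upwards [hae] with s ⟨C, hC⟩
      obtain ⟨n0, hn0⟩ := exists_nat_gt (C / (b - a))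
      rw [div_lt_iff₀ (by linarith)] at hn0
      obtain ⟨k, hk, hck⟩ := frequently_atTop.1 hC (n0 + 1)
      refine ⟨k, by omega, hck.trans ?_⟩
      have hk' : (n0 : ℝ) ≤ k := by exact_mod_cast (by omega : n0 ≤ k)
      nlinarith
    have hae : ∀ᵐ s ∂(seqLaw ν), s ∉ D := measure_eq_zero_iff_ae_notMem.1 hD0
    filter_upwards [hae] with s hs _ _
    by_contra hcon
    refine hs ⟨0, ?_⟩
    rw [not_eventually] at hcon
    simpa using hcon
  filter_upwards [hup, hlow] with s hs1 hs2
  refine tendsto_order.2 ⟨fun a ha => ?_, fun b hb => ?_⟩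
  · by_cases ha0 : a < 0
    · exact Eventually.of_forall fun n => ha0.trans_le (div_nonneg (h0 n s) (by positivity))
    · obtain ⟨q, haq, hq⟩ := exists_rat_btwn ha
      filter_upwards [hs2 q (by linarith) hq, eventually_gt_atTop 0] with n hn hn0
      have : (0 : ℝ) < n := by exact_mod_cast hn0
      rw [lt_div_iff₀ this]
      nlinarith
  · obtain ⟨m, hm⟩ := exists_lt_of_ciInf_lt hb
    obtain ⟨u, hu, hle'⟩ := hs1 m
    filter_upwards [hu.eventually_lt_const hm] with n hn
    exact (hle' n).trans_lt hn

end Subadditive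

/-! ### Green function, escape probabilities and capacity. -/

section Potential

/-- The partial sums of a sequence. -/
def partialSum {V : Type*} [AddCommMonoid V] (s : ℕ → V) (n : ℕ) : V := ∑ i ∈ Finset.range n, s i

section PartialSum

variable {V : Type*} [AddCommMonoid V]

@[simp] lemma partialSum_zero (s : ℕ → V) : partialSum s 0 = 0 := by
  simp [partialSum]

lemma partialSum_add (s : ℕ → V) (m n : ℕ) :
    partialSum s (m + n) = partialSum s m + partialSum (shift m s) n := by
  simp [partialSum, shift, Finset.sum_range_add]

lemma dependsOn_partialSum {m n : ℕ} (h : m ≤ n) :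
    DependsOn (fun s : ℕ → V => partialSum s m) (Set.Iio n) := by
  intro s t hst
  refine Finset.sum_congr rfl fun i hi => hst i ?_
  simp only [Finset.mem_range, Set.mem_Iio] at hi ⊢
  omega

end PartialSum

variable {V : Type*} [AddCommGroup V]

/-- The event that time `n` is the last visit to `A` of the walk started at `x`. -/
def lastExit (A : Set V) (x : V) (n : ℕ) : Set (ℕ → V) :=
  {s | x + partialSum s n ∈ A ∧ ∀ k, 1 ≤ k → x + partialSum s (n + k) ∉ A}

lemma pairwise_disjoint_lastExit (A : Set V) (x : V) :
    Pairwise (Function.onFun Disjoint (lastExit A x)) := by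
  have key : ∀ i j, i < j → Disjoint (lastExit A x i) (lastExit A x j) := by
    refine fun i j hij => Set.disjoint_left.2 fun s hi hj => ?_
    obtain ⟨k, rfl⟩ := Nat.exists_eq_add_of_lt hij
    exact hi.2 (k + 1) (by omega) hj.1
  intro i j hij
  rcases lt_or_gt_of_ne hij with h | h
  · exact key i j h
  · exact (key j i h).symm

variable [MeasurableSpace V] (ν : Measure V)

/-- The probability that the walk started at the origin is at `x` at time `n`. -/
noncomputable def stepProb (n : ℕ) (x : V) : ℝ≥0∞ := seqLaw ν {s | partialSum s n = x}

/-- The Green function `∑ₙ pₙ(x)`. -/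
noncomputable def greenFn (x : V) : ℝ≥0∞ := ∑' n, stepProb ν n x

/-- The probability that the walk started at `x` never visits `A` at a positive time. -/
noncomputable def escape (A : Set V) (x : V) : ℝ≥0∞ :=
  seqLaw ν {s | ∀ k, 1 ≤ k → x + partialSum s k ∉ A}

/-- The capacity of a finite set. -/
noncomputable def finCap (A : Finset V) : ℝ≥0∞ := ∑ x ∈ A, escape ν A x

lemma escape_anti {A B : Set V} (h : A ⊆ B) (x : V) : escape ν B x ≤ escape ν A x :=
  measure_mono fun _ hs k hk hA => hs k hk (h hA)

lemma escape_vadd (A : Set V) (v x : V) : escape ν ((v + ·) '' A) (v + x) = escape ν A x := by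
  unfold escape
  congr 1
  ext s
  simp [add_assoc]

lemma escape_le_one [IsProbabilityMeasure ν] (A : Set V) (x : V) : escape ν A x ≤ 1 := prob_le_one

lemma escape_singleton (x : V) : escape ν {x} x = escape ν {0} 0 := by
  simp [escape]

lemma one_le_greenFn_zero [IsProbabilityMeasure ν] : 1 ≤ greenFn ν (0 : V) := by
  refine le_trans ?_ (ENNReal.le_tsum 0)
  simp [stepProb]

lemma finCap_union_le [DecidableEq V] (A B : Finset V) :
    finCap ν (A ∪ B) ≤ finCap ν A + finCap ν B := by
  unfold finCap
  refine (le_self_add.trans_eq Finset.sum_union_inter).trans ?_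
  exact add_le_add (Finset.sum_le_sum fun x _ => escape_anti ν (by simp) x)
    (Finset.sum_le_sum fun x _ => escape_anti ν (by simp) x)

lemma finCap_vadd [DecidableEq V] (A : Finset V) (v : V) :
    finCap ν (A.image (v + ·)) = finCap ν A := by
  unfold finCap
  rw [Finset.sum_image fun _ _ _ _ h => add_left_cancel h]
  refine Finset.sum_congr rfl fun x _ => ?_
  rw [Finset.coe_image, escape_vadd]

lemma finCap_le_card [IsProbabilityMeasure ν] (A : Finset V) : finCap ν A ≤ A.card := by
  refine (Finset.sum_le_sum fun x _ => escape_le_one ν _ x).trans_eq (by simp)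

/-- A walk from `x` that never returns to `x` either avoids `A` or hits another point `y` of `A`;
hitting `y` has probability at most `G(y - x)`. -/
lemma escape_zero_le [DecidableEq V] (A : Finset V) (x : V) :
    escape ν {0} 0 ≤ escape ν A x + ∑ y ∈ A.erase x, greenFn ν (y - x) := by
  have hsub : {s : ℕ → V | ∀ k, 1 ≤ k → x + partialSum s k ∉ ({x} : Set V)} ⊆
      {s | ∀ k, 1 ≤ k → x + partialSum s k ∉ (A : Set V)} ∪
        ⋃ y ∈ A.erase x, ⋃ n, {s | partialSum s n = y - x} := by
    intro s hs
    by_contra hcon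
    simp only [Set.mem_union, Set.mem_iUnion, Set.mem_ofPred_eq, not_or, not_exists] at hcon
    refine hcon.1 fun k hk hA => hcon.2 (x + partialSum s k) (Finset.mem_erase.2 ⟨hs k hk, hA⟩) k ?_
    abel
  rw [← escape_singleton ν x]
  refine (measure_mono hsub).trans ((measure_union_le _ _).trans (add_le_add le_rfl ?_))
  refine (measure_biUnion_finset_le _ _).trans (Finset.sum_le_sum fun y _ => ?_)
  exact measure_iUnion_le _

/-- A lower bound for the capacity of a set of points listed with possible repetitions. -/
lemma card_mul_escape_le [IsProbabilityMeasure ν] [DecidableEq V] (I : Finset ℕ) (f : ℕ → V) :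
    I.card * escape ν {0} (0 : V) ≤
      finCap ν (I.image f) + ∑ i ∈ I, ∑ j ∈ I.erase i, greenFn ν (f j - f i) := by
  classical
  -- Keep the first index of each value. A later repetition needs no escape term: its error sum
  -- contains `G(0) ≥ 1`.
  let u : Finset ℕ := I.filter fun i => ∀ j ∈ I, j < i → f j ≠ f i
  have hinj : Set.InjOn f u := by
    intro i hi j hj hij
    simp only [u, Finset.coe_filter, Set.mem_ofPred_eq] at hi hj
    rcases lt_trichotomy i j with h | h | h
    · exact absurd hij (hj.2 i hi.1 h)
    · exact h
    · exact absurd hij.symm (hi.2 j hj.1 h)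
  have hterm : ∀ i ∈ I, escape ν {0} (0 : V) ≤
      (if ∀ j ∈ I, j < i → f j ≠ f i then escape ν (I.image f) (f i) else 0) +
        ∑ j ∈ I.erase i, greenFn ν (f j - f i) := by
    intro i hi
    split_ifs with h
    · refine (escape_zero_le ν (I.image f) (f i)).trans (add_le_add le_rfl ?_)
      have hsub : (I.image f).erase (f i) ⊆ (I.erase i).image f := by
        intro y hy
        obtain ⟨hne, hy⟩ := Finset.mem_erase.1 hy
        obtain ⟨j, hj, rfl⟩ := Finset.mem_image.1 hy
        exact Finset.mem_image_of_mem f (Finset.mem_erase.2 ⟨fun hji => hne (hji ▸ rfl), hj⟩)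
      exact (Finset.sum_le_sum_of_subset hsub).trans
        (Finset.sum_image_le_of_nonneg fun _ _ => zero_le)
    · push Not at h
      obtain ⟨j, hj, hji, hf⟩ := h
      rw [zero_add]
      refine (escape_le_one ν _ _).trans ((one_le_greenFn_zero ν (V := V)).trans ?_)
      have := Finset.single_le_sum (f := fun j => greenFn ν (f j - f i)) (fun _ _ => zero_le)
        (Finset.mem_erase.2 ⟨hji.ne, hj⟩)
      simpa [hf] using this
  calc I.card * escape ν {0} (0 : V) = ∑ i ∈ I, escape ν {0} (0 : V) := by simp
    _ ≤ _ := Finset.sum_le_sum hterm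
    _ = ∑ i ∈ u, escape ν (I.image f) (f i) + ∑ i ∈ I, ∑ j ∈ I.erase i, greenFn ν (f j - f i) := by
        rw [Finset.sum_add_distrib, Finset.sum_filter]
    _ = ∑ x ∈ u.image f, escape ν (I.image f) x +
          ∑ i ∈ I, ∑ j ∈ I.erase i, greenFn ν (f j - f i) := by
        rw [Finset.sum_image hinj]
    _ ≤ _ := add_le_add (Finset.sum_le_sum_of_subset
        (Finset.image_subset_image (Finset.filter_subset _ _))) le_rfl

variable [Countable V] [MeasurableSingletonClass V]

lemma measurable_partialSum (n : ℕ) : Measurable fun s : ℕ → V => partialSum s n :=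
  measurable_of_dependsOn_Iio (dependsOn_partialSum le_rfl)

lemma measurableSet_partialSum (n : ℕ) (B : Set V) :
    MeasurableSet {s : ℕ → V | partialSum s n ∈ B} :=
  measurable_partialSum n B.to_countable.measurableSet

lemma measurableSet_escape (A : Set V) (x : V) :
    MeasurableSet {s : ℕ → V | ∀ k, 1 ≤ k → x + partialSum s k ∉ A} := by
  simp only [Set.ofPred_forall]
  exact MeasurableSet.iInter fun k => MeasurableSet.iInter fun _ =>
    measurableSet_partialSum k {y | x + y ∉ A}

variable [IsProbabilityMeasure ν]

/-- The Markov property at the fixed time `m`. -/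
lemma measure_partialSum_and_shift (m : ℕ) (y : V) {B : Set (ℕ → V)} (hB : MeasurableSet B) :
    seqLaw ν {s | partialSum s m = y ∧ shift m s ∈ B} = stepProb ν m y * seqLaw ν B := by
  have h := (indepFun_of_dependsOn_shift ν (dependsOn_partialSum (V := V) (le_refl m))
    measurable_id).measure_inter_preimage_eq_mul {y} B (measurableSet_singleton y) hB
  have h2 := (measurePreserving_shift ν m).measure_preimage hB.nullMeasurableSet
  have h3 : (fun s : ℕ → V => id (shift m s)) ⁻¹' B = shift m ⁻¹' B := rfl
  rw [h3, h2] at h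
  exact h

lemma tsum_measure_partialSum_and_shift (m : ℕ) {E : Set (ℕ → V)} (B : V → Set (ℕ → V))
    (hB : ∀ y, MeasurableSet (B y)) (hE : ∀ s, s ∈ E ↔ shift m s ∈ B (partialSum s m)) :
    seqLaw ν E = ∑' y, stepProb ν m y * seqLaw ν (B y) := by
  have hE' : E = ⋃ y, {s | partialSum s m = y ∧ shift m s ∈ B y} := by
    ext s
    simp [hE]
  rw [hE', measure_iUnion]
  · exact tsum_congr fun y => measure_partialSum_and_shift ν m y (hB y)
  · intro y z hyz
    exact Set.disjoint_left.2 fun s hy hz => hyz (hy.1.symm.trans hz.1)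
  · intro y
    exact (measurableSet_partialSum m {y}).inter (measurable_shift m (hB y))

/-- The Chapman–Kolmogorov equation. -/
lemma stepProb_add (m n : ℕ) (x : V) :
    stepProb ν (m + n) x = ∑' y, stepProb ν m y * stepProb ν n (x - y) := by
  refine tsum_measure_partialSum_and_shift ν m (fun y => {s | partialSum s n = x - y})
    (fun y => measurableSet_partialSum n {x - y}) fun s => ?_
  simp [partialSum_add, eq_sub_iff_add_eq']

lemma tsum_stepProb (m : ℕ) : ∑' y, stepProb ν m y = 1 := by
  have := tsum_measure_partialSum_and_shift ν m (E := Set.univ) (fun _ : V => Set.univ)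
    (fun _ => MeasurableSet.univ) (by simp)
  simpa using this.symm

/-! ### Consequences of symmetry. -/

section Symmetric

variable {ν} (hsymm : ∀ x, stepProb ν 1 (-x) = stepProb ν 1 x)

include hsymm

lemma stepProb_neg (n : ℕ) (x : V) : stepProb ν n (-x) = stepProb ν n x := by
  induction n generalizing x with
  | zero => simp [stepProb, eq_comm]
  | succ n ih =>
    rw [add_comm n 1, stepProb_add, stepProb_add, ← (Equiv.neg V).tsum_eq]
    refine tsum_congr fun y => ?_
    rw [Equiv.neg_apply, hsymm, ← ih (x - y)]
    congr 2
    abel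

lemma greenFn_neg (x : V) : greenFn ν (-x) = greenFn ν x :=
  tsum_congr fun n => stepProb_neg hsymm n x

lemma stepProb_add_zero (m n : ℕ) :
    stepProb ν (m + n) 0 = ∑' y, stepProb ν m y * stepProb ν n y := by
  rw [stepProb_add]
  simp only [zero_sub, stepProb_neg hsymm]

lemma stepProb_even_le (n : ℕ) (x : V) : stepProb ν (n + n) x ≤ stepProb ν (n + n) 0 := by
  -- Used in place of Cauchy–Schwarz; both resulting sums of squares equal `p_{2n}(0)`.
  have amgm : ∀ a b : ℝ≥0∞, 2 * (a * b) ≤ a * a + b * b := by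
    intro a b
    rcases le_total a b with h | h <;> obtain ⟨c, rfl⟩ := exists_add_of_le h
    · calc _ ≤ 2 * (a * (a + c)) + c * c := le_self_add
        _ = _ := by ring
    · calc _ ≤ 2 * ((b + c) * b) + c * c := le_self_add
        _ = _ := by ring
  refine (ENNReal.mul_le_mul_iff_right two_ne_zero ENNReal.ofNat_ne_top).1 ?_
  rw [stepProb_add, ← ENNReal.tsum_mul_left]
  refine (ENNReal.tsum_le_tsum fun y => amgm _ _).trans_eq ?_
  have h := (Equiv.subLeft x).tsum_eq fun y => stepProb ν n y * stepProb ν n y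
  simp only [Equiv.subLeft_apply] at h
  rw [ENNReal.tsum_add, h, ← stepProb_add_zero hsymm, two_mul]

/-- Even times are controlled by `p_{2n}(0)`, and conditioning on one step bounds time `2n + 1` by
the same quantity, hence the factor 2. Finiteness of `G` thus passes from the origin to every point.
-/
lemma greenFn_le (x : V) : greenFn ν x ≤ 2 * greenFn ν 0 := by
  have heven : ∀ n x, stepProb ν (2 * n) x ≤ stepProb ν (2 * n) 0 := fun n x => by
    rw [two_mul]
    exact stepProb_even_le hsymm n x
  have hodd : ∀ n, stepProb ν (2 * n + 1) x ≤ stepProb ν (2 * n) 0 := fun n => by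
    rw [add_comm, stepProb_add]
    refine (ENNReal.tsum_le_tsum fun y => mul_le_mul_right (heven n (x - y)) _).trans_eq ?_
    rw [ENNReal.tsum_mul_right, tsum_stepProb, one_mul]
  have hsum : ∑' n, stepProb ν (2 * n) (0 : V) ≤ greenFn ν 0 :=
    ENNReal.tsum_comp_le_tsum_of_injective
      (fun a b h => by simpa using h : Function.Injective fun n : ℕ => 2 * n) _
  unfold greenFn at hsum ⊢
  rw [← tsum_even_add_odd ENNReal.summable ENNReal.summable, two_mul]
  exact add_le_add ((ENNReal.tsum_le_tsum fun n => heven n x).trans hsum)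
    ((ENNReal.tsum_le_tsum hodd).trans hsum)

end Symmetric

/-! ### Last exit decomposition and monotonicity of capacity. -/

section LastExit

lemma measurableSet_lastExit (A : Set V) (x : V) (n : ℕ) : MeasurableSet (lastExit A x n) := by
  unfold lastExit
  simp only [Set.ofPred_and, Set.ofPred_forall]
  exact (measurableSet_partialSum n {y | x + y ∈ A}).inter (MeasurableSet.iInter fun k =>
    MeasurableSet.iInter fun _ => measurableSet_partialSum (n + k) {y | x + y ∉ A})

lemma measure_lastExit (A : Finset V) (x : V) (n : ℕ) :
    seqLaw ν (lastExit (A : Set V) x n) = ∑ y ∈ A, stepProb ν n (y - x) * escape ν A y := by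
  have h : lastExit (A : Set V) x n = ⋃ y ∈ A, {s | partialSum s n = y - x ∧
      shift n s ∈ {s | ∀ k, 1 ≤ k → y + partialSum s k ∉ (A : Set V)}} := by
    ext s
    simp only [lastExit, Set.mem_iUnion, Set.mem_ofPred_eq, partialSum_add, exists_prop,
      Finset.mem_coe]
    constructor
    · rintro ⟨h1, h2⟩
      exact ⟨_, h1, by abel, fun k hk => by simpa [add_assoc] using h2 k hk⟩
    · rintro ⟨y, hy, h1, h2⟩
      rw [h1, add_sub_cancel]
      refine ⟨hy, fun k hk => ?_⟩
      rw [← add_assoc, add_sub_cancel]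
      exact h2 k hk
  rw [h, measure_biUnion_finset]
  · exact Finset.sum_congr rfl fun y _ =>
      measure_partialSum_and_shift ν n (y - x) (measurableSet_escape _ y)
  · intro y _ z _ hyz
    exact Set.disjoint_left.2 fun s hy hz => hyz (sub_left_injective (hy.1.symm.trans hz.1))
  · intro y _
    exact (measurableSet_partialSum n {y - x}).inter
      (measurable_shift n (measurableSet_escape _ y))

lemma measure_iUnion_lastExit (A : Finset V) (x : V) :
    seqLaw ν (⋃ n, lastExit (A : Set V) x n) = ∑ y ∈ A, greenFn ν (y - x) * escape ν A y := by
  rw [measure_iUnion (pairwise_disjoint_lastExit _ x) (measurableSet_lastExit _ x)]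
  simp only [measure_lastExit, greenFn, ← ENNReal.tsum_mul_right]
  exact Summable.tsum_finsetSum fun _ _ => ENNReal.summable

lemma sum_greenFn_mul_escape_le_one (A : Finset V) (x : V) :
    ∑ y ∈ A, greenFn ν (y - x) * escape ν A y ≤ 1 := by
  rw [← measure_iUnion_lastExit]
  exact prob_le_one

/-- The last exit decomposition. -/
lemma sum_greenFn_mul_escape (hG : ∀ x, greenFn ν x ≠ ∞) (A : Finset V) {x : V} (hx : x ∈ A) :
    ∑ y ∈ A, greenFn ν (y - x) * escape ν A y = 1 := by
  rw [← measure_iUnion_lastExit, ← mem_ae_iff_prob_eq_one (MeasurableSet.iUnion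
    (measurableSet_lastExit _ x))]
  -- By Borel–Cantelli each point is visited finitely often; as time `0` is a visit to `A`, a last
  -- visit exists.
  have hfin : ∀ y ∈ A, ∀ᵐ s ∂(seqLaw ν), ∀ᶠ n in atTop, x + partialSum s n ≠ y := by
    intro y _
    have h := ae_eventually_notMem (μ := seqLaw ν) (s := fun n => {s | partialSum s n = y - x})
      (hG (y - x))
    filter_upwards [h] with s hs
    filter_upwards [hs] with n hn h
    exact hn (by simp [← h])
  filter_upwards [(eventually_all_finset A).2 hfin] with s hs
  obtain ⟨N, hN⟩ := eventually_atTop.1 ((eventually_all_finset A).2 hs)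
  let T : Set ℕ := {n | x + partialSum s n ∈ (A : Set V)}
  have hbdd : BddAbove T := ⟨N, fun n hn => not_lt.1 fun h => hN n h.le _ hn rfl⟩
  have hmem : sSup T ∈ T := Nat.sSup_mem ⟨0, by simpa [T] using hx⟩ hbdd
  refine Set.mem_iUnion.2 ⟨sSup T, hmem, fun k hk hA => ?_⟩
  have : sSup T + k ≤ sSup T := le_csSup hbdd hA
  omega

end LastExit

/-- Insert the last exit identity for `A` at each point of `B`, exchange the sums using `G(-x) =
G(x)`, and bound the inner sum, the probability of ever visiting `B`, by one. -/
lemma finCap_mono (hsymm : ∀ x, stepProb ν 1 (-x) = stepProb ν 1 x)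
    (hG : ∀ x, greenFn ν x ≠ ∞) {A B : Finset V} (h : B ⊆ A) : finCap ν B ≤ finCap ν A := by
  calc finCap ν B = ∑ x ∈ B, escape ν B x * ∑ y ∈ A, greenFn ν (y - x) * escape ν A y :=
        Finset.sum_congr rfl fun x hx => by rw [sum_greenFn_mul_escape ν hG A (h hx), mul_one]
    _ = ∑ y ∈ A, escape ν A y * ∑ x ∈ B, greenFn ν (x - y) * escape ν B x := by
        simp only [Finset.mul_sum]
        rw [Finset.sum_comm]
        refine Finset.sum_congr rfl fun y _ => Finset.sum_congr rfl fun x _ => ?_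
        rw [← greenFn_neg hsymm (x - y), neg_sub]
        ring
    _ ≤ finCap ν A := Finset.sum_le_sum fun y _ =>
        mul_le_of_le_one_right' (sum_greenFn_mul_escape_le_one ν B y)

lemma escape_zero_pos (hG : ∀ x, greenFn ν (x : V) ≠ ∞) : escape ν {0} (0 : V) ≠ 0 := by
  intro h
  have := sum_greenFn_mul_escape ν hG {(0 : V)} (Finset.mem_singleton_self 0)
  simp [h] at this

/-! ### Linear growth of the expected capacity. -/

section Increments

variable {ν} (hsymm : ∀ x, stepProb ν 1 (-x) = stepProb ν 1 x)

include hsymm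

lemma lintegral_greenFn_increment {a b : ℕ} (hab : a ≤ b) :
    ∫⁻ s, greenFn ν (partialSum s b - partialSum s a) ∂(seqLaw ν) =
      ∑' k, stepProb ν (b - a + k) (0 : V) := by
  obtain ⟨m, rfl⟩ := Nat.exists_eq_add_of_le hab
  have hG : Measurable (greenFn ν : V → ℝ≥0∞) := Measurable.of_discrete
  have h1 : ∫⁻ s, greenFn ν (partialSum s (a + m) - partialSum s a) ∂(seqLaw ν) =
      ∫⁻ s, greenFn ν (partialSum s m : V) ∂(seqLaw ν) := by
    simp only [partialSum_add, add_sub_cancel_left]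
    exact (measurePreserving_shift ν a).lintegral_comp (hG.comp (measurable_partialSum m))
  rw [h1, ← lintegral_map hG (measurable_partialSum m), lintegral_countable',
    Nat.add_sub_cancel_left]
  have h2 : ∀ y, (seqLaw ν).map (fun s => partialSum s m) {y} = stepProb ν m y := fun y =>
    Measure.map_apply (measurable_partialSum m) (measurableSet_singleton y)
  simp only [h2, stepProb_add_zero hsymm, greenFn, ← ENNReal.tsum_mul_right]
  rw [ENNReal.tsum_comm]
  simp only [mul_comm]

/-- With truncated subtraction, `(b - a) + (a - b)` is the distance `|b - a|`. -/
lemma lintegral_greenFn_increment' (a b : ℕ) :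
    ∫⁻ s, greenFn ν (partialSum s b - partialSum s a) ∂(seqLaw ν) =
      ∑' k, stepProb ν ((b - a) + (a - b) + k) (0 : V) := by
  rcases le_total a b with h | h
  · rw [lintegral_greenFn_increment hsymm h, Nat.sub_eq_zero_of_le h, add_zero]
  · have hneg : ∀ s : ℕ → V, greenFn ν (partialSum s b - partialSum s a) =
        greenFn ν (partialSum s a - partialSum s b) := fun s => by
      rw [← greenFn_neg hsymm, neg_sub]
    rw [lintegral_congr hneg, lintegral_greenFn_increment hsymm h, Nat.sub_eq_zero_of_le h, zero_add]

end Increments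

/-- Each positive distance from `i` is attained at most twice, once on either side. -/
lemma sum_erase_dist_le (h : ℕ → ℝ≥0∞) (N i : ℕ) :
    ∑ j ∈ (Finset.range N).erase i, h ((j - i) + (i - j)) ≤ 2 * ∑' d, h (d + 1) := by
  have hsub : (Finset.range N).erase i ⊆ Finset.range i ∪ Finset.Ico (i + 1) N := by
    intro j hj
    simp only [Finset.mem_erase, Finset.mem_range, Finset.mem_union, Finset.mem_Ico] at hj ⊢
    omega
  refine (Finset.sum_le_sum_of_subset hsub).trans
    ((le_self_add.trans_eq Finset.sum_union_inter).trans ?_)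
  rw [two_mul]
  refine add_le_add ?_ ?_
  · rw [← Finset.sum_range_reflect]
    refine (Finset.sum_congr rfl fun j hj => ?_).trans_le (ENNReal.sum_le_tsum (Finset.range i))
    rw [Finset.mem_range] at hj
    congr 1
    omega
  · rw [Finset.sum_Ico_eq_sum_range]
    refine (Finset.sum_congr rfl fun j hj => ?_).trans_le
      (ENNReal.sum_le_tsum (Finset.range (N - (i + 1))))
    congr 1
    omega

/-- There are `n + 1` ways to write `n = m + k`. -/
lemma tsum_tsum_add_eq (f : ℕ → ℝ≥0∞) : ∑' m, ∑' k, f (m + k) = ∑' n : ℕ, (n + 1) * f n := by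
  rw [← ENNReal.tsum_prod (f := fun m k => f (m + k)),
    ← Finset.HasAntidiagonal.sigmaAntidiagonalEquivProd.tsum_eq, ENNReal.tsum_sigma']
  refine tsum_congr fun n => ?_
  rw [tsum_fintype, Finset.sum_congr rfl (g := fun _ => f n)]
  · simp
  · rintro ⟨⟨a, b⟩, hx⟩ _
    rw [Finset.HasAntidiagonal.mem_antidiagonal] at hx
    simp only at hx
    simp [Finset.HasAntidiagonal.sigmaAntidiagonalEquivProd, hx]

/-- For a strongly transient symmetric walk the expected capacity of any set containing the range
grows at least linearly. -/
lemma exists_linear_lower_bound (hsymm : ∀ x, stepProb ν 1 (-x) = stepProb ν 1 x)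
    (h0 : greenFn ν (0 : V) ≠ ∞) (h1 : ∑' n : ℕ, n * stepProb ν n (0 : V) ≠ ∞) [DecidableEq V] :
    ∃ δ : ℝ≥0∞, δ ≠ 0 ∧ δ ≠ ∞ ∧ ∀ n : ℕ,
      δ * n ≤ ∫⁻ s, finCap ν ((Finset.range (n + 1)).image (partialSum s)) ∂(seqLaw ν) := by
  have hG : ∀ x, greenFn ν (x : V) ≠ ∞ := fun x =>
    ne_top_of_le_ne_top (ENNReal.mul_ne_top ENNReal.ofNat_ne_top h0) (greenFn_le hsymm x)
  set q := escape ν {0} (0 : V) with hq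
  have hq0 : q ≠ 0 := escape_zero_pos ν hG
  have hqtop : q ≠ ∞ := ne_top_of_le_ne_top ENNReal.one_ne_top (escape_le_one ν _ _)
  -- `g m` is the mean of `G(S_m)`.
  let g : ℕ → ℝ≥0∞ := fun m => ∑' k, stepProb ν (m + k) (0 : V)
  have hg : ∑' m, g m ≠ ∞ := by
    simp only [g, tsum_tsum_add_eq fun n => stepProb ν n (0 : V), add_mul, one_mul]
    rw [ENNReal.tsum_add]
    exact ENNReal.add_ne_top.2 ⟨h1, h0⟩
  have hq4 : 0 < q / 4 := ENNReal.div_pos hq0 ENNReal.ofNat_ne_top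
  obtain ⟨L, hL, hLpos⟩ := (((ENNReal.tendsto_sum_nat_add g hg).eventually_lt_const hq4).and
    (eventually_gt_atTop 0)).exists
  have hL0 : (L : ℝ≥0∞) ≠ 0 := by exact_mod_cast hLpos.ne'
  -- One retained point per `L` steps, each contributing at least `q / 2`.
  refine ⟨q / 2 / L, ?_, ?_, fun n => ?_⟩
  · exact (ENNReal.div_pos (ENNReal.div_pos hq0 ENNReal.ofNat_ne_top).ne'
      (ENNReal.natCast_ne_top L)).ne'
  · exact ENNReal.div_ne_top (ENNReal.div_ne_top hqtop two_ne_zero) hL0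
  let M := n / L
  have hpt : ∀ s : ℕ → V, ((M + 1 : ℕ) : ℝ≥0∞) * q ≤
      finCap ν ((Finset.range (n + 1)).image (partialSum s)) +
        ∑ i ∈ Finset.range (M + 1), ∑ j ∈ (Finset.range (M + 1)).erase i,
          greenFn ν (partialSum s (L * j) - partialSum s (L * i)) := by
    intro s
    have h := card_mul_escape_le ν (Finset.range (M + 1)) fun i => partialSum s (L * i)
    rw [Finset.card_range] at h
    refine h.trans (add_le_add (finCap_mono ν hsymm hG fun y hy => ?_) le_rfl)
    obtain ⟨i, hi, rfl⟩ := Finset.mem_image.1 hy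
    refine Finset.mem_image_of_mem _ (Finset.mem_range.2 (Nat.lt_succ_of_le ?_))
    exact (Nat.mul_le_mul_left L (Nat.lt_succ_iff.1 (Finset.mem_range.1 hi))).trans
      (Nat.mul_div_le n L)
  have hmeas : ∀ i j, Measurable fun s : ℕ → V =>
      greenFn ν (partialSum s (L * j) - partialSum s (L * i)) := fun i j =>
    (Measurable.of_discrete (f := (greenFn ν : V → ℝ≥0∞))).comp
      ((Measurable.of_discrete (f := fun p : V × V => p.1 - p.2)).comp
        ((measurable_partialSum _).prodMk (measurable_partialSum _)))
  have herr : ∫⁻ s, ∑ i ∈ Finset.range (M + 1), ∑ j ∈ (Finset.range (M + 1)).erase i,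
      greenFn ν (partialSum s (L * j) - partialSum s (L * i)) ∂(seqLaw ν) ≤
        ((M + 1 : ℕ) : ℝ≥0∞) * (q / 2) := by
    rw [lintegral_finsetSum _ fun i _ => Finset.measurable_sum _ fun j _ => hmeas i j]
    have hrow : ∀ i ∈ Finset.range (M + 1), ∫⁻ s, ∑ j ∈ (Finset.range (M + 1)).erase i,
        greenFn ν (partialSum s (L * j) - partialSum s (L * i)) ∂(seqLaw ν) ≤ q / 2 := by
      intro i _
      rw [lintegral_finsetSum _ fun j _ => hmeas i j]
      calc _ = ∑ j ∈ (Finset.range (M + 1)).erase i, g (L * ((j - i) + (i - j))) := by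
            refine Finset.sum_congr rfl fun j _ => ?_
            rw [lintegral_greenFn_increment' hsymm]
            simp only [g, mul_add, Nat.mul_sub]
        _ ≤ 2 * ∑' d, g (L * (d + 1)) := sum_erase_dist_le (fun d => g (L * d)) _ i
        -- The multiples `L (d + 1)` are among the integers `m + L`, so the tail beyond `L`
        -- dominates.
        _ ≤ 2 * ∑' m, g (m + L) := by
            refine mul_le_mul_right ?_ 2
            simp only [mul_add, mul_one]
            exact ENNReal.tsum_comp_le_tsum_of_injective
              (f := fun d => L * d) (mul_right_injective₀ hLpos.ne') fun m => g (m + L)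
        _ ≤ 2 * (q / 4) := mul_le_mul_right hL.le 2
        _ = q / 2 := by
            rw [← ENNReal.toReal_eq_toReal_iff' (ENNReal.mul_ne_top ENNReal.ofNat_ne_top
              (ENNReal.div_ne_top hqtop (by simp))) (ENNReal.div_ne_top hqtop two_ne_zero)]
            simp only [ENNReal.toReal_mul, ENNReal.toReal_div, ENNReal.toReal_ofNat]
            ring
    refine (Finset.sum_le_sum hrow).trans_eq ?_
    rw [Finset.sum_const, Finset.card_range, nsmul_eq_mul]
  have hint := lintegral_mono (μ := seqLaw ν) hpt
  rw [lintegral_const, measure_univ, mul_one, lintegral_add_right _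
    (Finset.measurable_sum _ fun i _ => Finset.measurable_sum _ fun j _ => hmeas i j)] at hint
  have hmain : ((M + 1 : ℕ) : ℝ≥0∞) * (q / 2) ≤
      ∫⁻ s, finCap ν ((Finset.range (n + 1)).image (partialSum s)) ∂(seqLaw ν) := by
    have hfin : ((M + 1 : ℕ) : ℝ≥0∞) * (q / 2) ≠ ∞ :=
      ENNReal.mul_ne_top (ENNReal.natCast_ne_top _) (ENNReal.div_ne_top hqtop two_ne_zero)
    refine (ENNReal.add_le_add_iff_right hfin).1 ?_
    rw [← mul_add, ENNReal.add_halves]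
    exact hint.trans (add_le_add le_rfl herr)
  refine le_trans ?_ hmain
  have hn : (n : ℝ≥0∞) ≤ L * (M + 1 : ℕ) := by
    exact_mod_cast (Nat.lt_mul_div_succ n hLpos).le
  calc q / 2 / L * n ≤ q / 2 / L * (L * (M + 1 : ℕ)) := mul_le_mul_right hn _
    _ = (M + 1 : ℕ) * (q / 2) := by
        rw [← mul_assoc, ENNReal.div_mul_cancel hL0 (ENNReal.natCast_ne_top L), mul_comm]

end Potential

/-! ### The capacity of the range as a subadditive process. -/

section RangeProcess

variable {V : Type*} [AddCommGroup V] [MeasurableSpace V] [DecidableEq V] (ν : Measure V)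

/-- The capacity of the first `n + 1` positions of the walk with the given steps. -/
noncomputable def seqCap (n : ℕ) (s : ℕ → V) : ℝ≥0∞ :=
  finCap ν ((Finset.range (n + 1)).image (partialSum s))

lemma dependsOn_seqCap (n : ℕ) : DependsOn (seqCap ν n) (Set.Iio n) := by
  intro s t hst
  unfold seqCap
  congr 1
  refine Finset.image_congr fun k hk => ?_
  exact dependsOn_partialSum (Nat.lt_succ_iff.1 (Finset.mem_range.1 hk)) hst

/-- After time `m` the path is a translate of the path with shifted steps. -/
lemma seqCap_add_le (m n : ℕ) (s : ℕ → V) :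
    seqCap ν (m + n) s ≤ seqCap ν m s + seqCap ν n (shift m s) := by
  have hrange : (Finset.range (m + n + 1)).image (partialSum s) ⊆
      (Finset.range (m + 1)).image (partialSum s) ∪
        ((Finset.range (n + 1)).image (partialSum (shift m s))).image (partialSum s m + ·) := by
    intro y hy
    obtain ⟨k, hk, rfl⟩ := Finset.mem_image.1 hy
    rw [Finset.mem_range] at hk
    rcases le_or_gt k m with h | h
    · exact Finset.mem_union_left _ (Finset.mem_image_of_mem _ (Finset.mem_range.2 (by omega)))
    · obtain ⟨r, rfl⟩ := Nat.exists_eq_add_of_le h.le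
      rw [partialSum_add]
      exact Finset.mem_union_right _ (Finset.mem_image_of_mem (partialSum s m + ·)
        (Finset.mem_image_of_mem _ (Finset.mem_range.2 (by omega))))
  have hrange' : (Finset.range (m + 1)).image (partialSum s) ∪
      ((Finset.range (n + 1)).image (partialSum (shift m s))).image (partialSum s m + ·) ⊆
        (Finset.range (m + n + 1)).image (partialSum s) := by
    refine Finset.union_subset (Finset.image_subset_image fun k hk => ?_) fun y hy => ?_
    · rw [Finset.mem_range] at hk ⊢
      omega
    · simp only [Finset.mem_image, Finset.mem_range] at hy ⊢
      obtain ⟨_, ⟨k, hk, rfl⟩, rfl⟩ := hy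
      exact ⟨m + k, by omega, partialSum_add s m k⟩
  unfold seqCap
  rw [hrange.antisymm hrange']
  refine (finCap_union_le ν _ _).trans (add_le_add le_rfl ?_)
  rw [finCap_vadd]

lemma seqCap_le [IsProbabilityMeasure ν] (n : ℕ) (s : ℕ → V) :
    seqCap ν n s ≤ (n + 1 : ℕ) := by
  refine (finCap_le_card ν _).trans ?_
  exact_mod_cast Finset.card_image_le.trans_eq (Finset.card_range _)

/-- The capacity of the range of a strongly transient symmetric walk grows linearly. -/
theorem exists_pos_tendsto_seqCap [Countable V] [MeasurableSingletonClass V]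
    [IsProbabilityMeasure ν] (hsymm : ∀ x, stepProb ν 1 (-x) = stepProb ν 1 x)
    (h0 : greenFn ν (0 : V) ≠ ∞) (h1 : ∑' n : ℕ, n * stepProb ν n (0 : V) ≠ ∞) :
    ∃ γ : ℝ, (∀ᵐ s ∂(seqLaw ν),
      Tendsto (fun n : ℕ => (seqCap ν n s).toReal / n) atTop (𝓝 γ)) ∧ 0 < γ := by
  have htop : ∀ n s, seqCap ν n s ≠ ∞ := fun n s =>
    ne_top_of_le_ne_top (ENNReal.natCast_ne_top _) (seqCap_le ν n s)
  obtain ⟨γ, hγ, hlow⟩ := exists_tendsto_of_subadditive ν (c := fun n s => (seqCap ν n s).toReal)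
    (fun n s t hst => congrArg ENNReal.toReal (dependsOn_seqCap ν n hst))
    (fun n s => ENNReal.toReal_nonneg)
    (fun n s => by
      have := ENNReal.toReal_mono (ENNReal.natCast_ne_top _) (seqCap_le ν n s)
      rwa [ENNReal.toReal_natCast, Nat.cast_add_one] at this)
    (fun m n s => by
      rw [← ENNReal.toReal_add (htop _ _) (htop _ _)]
      exact ENNReal.toReal_mono (ENNReal.add_ne_top.2 ⟨htop _ _, htop _ _⟩)
        (seqCap_add_le ν m n s))
  obtain ⟨δ, hδ0, hδtop, hδ⟩ := exists_linear_lower_bound ν hsymm h0 h1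
  -- A linear lower bound on the means bounds the almost sure limit, hence positivity.
  refine ⟨γ, hγ, (ENNReal.toReal_pos hδ0 hδtop).trans_le (hlow _ fun n _ => ?_)⟩
  rw [integral_toReal (measurable_of_dependsOn_Iio (dependsOn_seqCap ν n)).aemeasurable
    (ae_of_all _ fun s => (htop n s).lt_top)]
  have hfin : ∫⁻ s, seqCap ν n s ∂(seqLaw ν) ≠ ∞ := by
    refine ne_top_of_le_ne_top (ENNReal.natCast_ne_top (n + 1))
      ((lintegral_mono (seqCap_le ν n)).trans_eq ?_)
    simp
  have := ENNReal.toReal_mono hfin (hδ n)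
  simpa using this

end RangeProcess

/-! ### Transfer from the sample space to the law of the step sequence. -/

section Transfer

variable {Ω : Type*} {d : ℕ} {X : ℕ → Ω → (Fin d → ℤ)}

lemma walk_eq (n : ℕ) (x : Fin d → ℤ) (ω : Ω) :
    walk X n (x, ω) = x + partialSum (fun i => X i ω) n := rfl

lemma returnTime_eq_top_iff (A : Set (Fin d → ℤ)) (w : (Fin d → ℤ) × Ω) :
    returnTime X A w = ⊤ ↔ ∀ k, 1 ≤ k → walk X k w ∉ A := by
  simp [returnTime, iInf_eq_top]

lemma visited_eq (n : ℕ) (ω : Ω) : visited X n (0, ω) =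
    ((Finset.range (n + 1)).image (partialSum fun i => X i ω) : Finset (Fin d → ℤ)) := by
  ext y
  simp [visited, walk_eq]

variable [MeasurableSpace Ω] {P : Measure Ω}

lemma measurable_walk (hmeas : ∀ i, Measurable (X i)) (n : ℕ) : Measurable (walk X n) := by
  unfold walk
  exact measurable_fst.add
    (Finset.measurable_sum _ fun i _ => (hmeas i).comp measurable_snd)

lemma map_steps_eq_seqLaw (hmeas : ∀ i, Measurable (X i)) (hindep : iIndepFun X P)
    (hident : ∀ i, IdentDistrib (X i) (X 0) P P) :
    P.map (fun ω i => X i ω) = seqLaw (P.map (X 0)) := by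
  rw [hindep.map_fun_eq_infinitePi_map hmeas]
  simp only [seqLaw, (hident _).map_eq]

variable [IsProbabilityMeasure P]

lemma startAt_apply (hmeas : ∀ i, Measurable (X i)) (hindep : iIndepFun X P)
    (hident : ∀ i, IdentDistrib (X i) (X 0) P P) (x : Fin d → ℤ)
    {E : Set ((Fin d → ℤ) × Ω)} (hE : MeasurableSet E) {B : Set (ℕ → Fin d → ℤ)}
    (hB : MeasurableSet B) (h : ∀ ω, (x, ω) ∈ E ↔ (fun i => X i ω) ∈ B) :
    startAt P x E = seqLaw (P.map (X 0)) B := by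
  rw [startAt, Measure.dirac_prod, Measure.map_apply measurable_prodMk_left hE,
    ← map_steps_eq_seqLaw hmeas hindep hident,
    Measure.map_apply (measurable_pi_iff.2 hmeas) hB]
  congr 1
  ext ω
  exact h ω

lemma transProb_zero_eq (hmeas : ∀ i, Measurable (X i)) (hindep : iIndepFun X P)
    (hident : ∀ i, IdentDistrib (X i) (X 0) P P) (n : ℕ) (x : Fin d → ℤ) :
    transProb P X n 0 x = stepProb (P.map (X 0)) n x :=
  startAt_apply hmeas hindep hident 0 (measurable_walk hmeas n (measurableSet_singleton x))
    (measurableSet_partialSum n {x}) fun ω => by simp [walk_eq]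

lemma capacity_coe_eq (hmeas : ∀ i, Measurable (X i)) (hindep : iIndepFun X P)
    (hident : ∀ i, IdentDistrib (X i) (X 0) P P) (A : Finset (Fin d → ℤ)) :
    capacity P X (A : Set (Fin d → ℤ)) = finCap (P.map (X 0)) A := by
  have hE : MeasurableSet {w : (Fin d → ℤ) × Ω | returnTime X (A : Set (Fin d → ℤ)) w = ⊤} := by
    simp only [returnTime_eq_top_iff, Set.ofPred_forall]
    exact MeasurableSet.iInter fun k => MeasurableSet.iInter fun _ =>
      measurable_walk hmeas k (Set.to_countable (A : Set (Fin d → ℤ))ᶜ).measurableSet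
  unfold capacity finCap
  rw [Finset.tsum_subtype' A fun x => startAt P x {w | returnTime X (A : Set (Fin d → ℤ)) w = ⊤}]
  refine Finset.sum_congr rfl fun x _ => ?_
  refine startAt_apply hmeas hindep hident x hE (measurableSet_escape _ x) fun ω => ?_
  simp only [Set.mem_ofPred_eq, returnTime_eq_top_iff, walk_eq]

end Transfer

end LatticeWalk

theorem mainTheorem6 {Ω : Type*} [MeasurableSpace Ω] (P : Measure Ω) [IsProbabilityMeasure P]
    (d : ℕ) (hd : 1 ≤ d) (X : ℕ → Ω → (Fin d → ℤ))
    (hmeas : ∀ i, Measurable (X i))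
    (hindep : iIndepFun X P)
    (hident : ∀ i, IdentDistrib (X i) (X 0) P P)
    (hsymm : LatticeWalk.IsSymmetric P X)
    (hst : LatticeWalk.IsStronglyTransient P X) :
    ∃ μ_d : ℝ,
      (∀ᵐ w ∂(LatticeWalk.startAt P (0 : Fin d → ℤ)),
        Tendsto (fun n : ℕ => LatticeWalk.capRange P X n w / (n : ℝ)) atTop (𝓝 μ_d)) ∧
      0 < μ_d := by
  have : IsProbabilityMeasure (P.map (X 0)) :=
    Measure.isProbabilityMeasure_map (hmeas 0).aemeasurable
  have hp := LatticeWalk.transProb_zero_eq hmeas hindep hident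
  obtain ⟨htrans, hstrong⟩ := hst
  simp only [LatticeWalk.IsTransient, LatticeWalk.green, hp] at htrans
  simp only [hp] at hstrong
  obtain ⟨γ, hγ, hpos⟩ := LatticeWalk.exists_pos_tendsto_seqCap (P.map (X 0))
    (fun x => by rw [← hp, ← hp]; exact (hsymm x).symm) htrans.ne hstrong.ne
  refine ⟨γ, ?_, hpos⟩
  rw [← LatticeWalk.map_steps_eq_seqLaw hmeas hindep hident] at hγ
  have hP := ae_of_ae_map (measurable_pi_iff.2 hmeas).aemeasurable hγ
  have hstart : ∀ᵐ w ∂(LatticeWalk.startAt P (0 : Fin d → ℤ)), w.1 = 0 :=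
    Measure.quasiMeasurePreserving_fst.ae (p := fun x : Fin d → ℤ => x = 0)
      ((ae_dirac_iff (measurableSet_singleton (0 : Fin d → ℤ))).2 rfl)
  filter_upwards [hstart, Measure.quasiMeasurePreserving_snd.ae hP] with w hw hlim
  obtain ⟨x, ω⟩ := w
  obtain rfl : x = 0 := hw
  refine hlim.congr fun n => ?_
  rw [LatticeWalk.capRange, LatticeWalk.visited_eq, LatticeWalk.capacity_coe_eq hmeas hindep hident,
    LatticeWalk.seqCap]
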